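/- Let $\omega\colon\mathbb{N}\to\mathbb{R}$ be any function with $\omega(n)\to\infty$ as $n\to\infty$. For a strictly increasing sequence $\vec m=(m_k)_{k\ge 1}$ of positive integers with $m_1=1$, and positive integers $j,j'$, write $j'\preceq j$ if either $j'<m_k\le j$ for some $k\ge 1$, or $m_k\le j<m_{k+1}$ and $m_k\le j'<m_{k+1}$ for some $k\ge 1$, and let $$\overline{\mathcal S}_{\vec m}=\big\langle x,y \;\big|\; x^2=x,\ \ xy^jxy^{j'}x=xy^jx \text{ for all } j,j'\ge 1 \text{ with } j'\preceq j\big\rangle ,$$ a semigroup with identity (monoid) given by generators and relations. Then there exists such a sequence $\vec m$, moreover with $m_{k+1}>2^{m_k}$ for all $k\ge 1$, for which the following holds. The set $\{x,y\}$ is a finite generating set of $S=\overline{\mathcal S}_{\vec m}$, and there is a simple random walk $R_n=X_1X_2\cdots X_n$ on $S$, where $X_1,X_2,\dots$ are independent and uniformly distributed on $\{x,y\}$, such that, with $|a|$ the least $k\ge 0$ for which $a\in S$ is a product of $k$ elements of $\{x,y\}$, all expectations $\mathbb{E}|R_n|$ are finite and $$\mathbb{E}|R_n|\le\omega(n)\quad\text{for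 infinitely many } n,\qquad\text{while}\qquad \mathbb{E}|R_n|\xrightarrow{n\to\infty}\infty .$$ In particular, for every such $\omega$ there are a finitely generated semigroup and a simple random walk on it whose speed function $n\mapsto\mathbb{E}|R_n|$ tends to infinity but is at most $\omega(n)$ for infinitely many $n$. -/

import Mathlib

open MeasureTheory ProbabilityTheory Filter

/-- The two letters of the alphabet. -/
inductive Letter : Type
  | x
  | y

/-- `j' ≺ j` with respect to the increasing sequence `m 0 < m 1 < ⋯`:
some term of the sequence separates `j'` from `j`. -/
def Prec (m : ℕ → ℕ) (j' j : ℕ) : Prop :=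
  ∃ k, j' < m k ∧ m k ≤ j

/-- `j' ⪯ j`: either `j' ≺ j`, or `j` and `j'` lie in a common interval `[m k, m (k + 1))`. -/
def PrecEq (m : ℕ → ℕ) (j' j : ℕ) : Prop :=
  Prec m j' j ∨ ∃ k, (m k ≤ j ∧ j < m (k + 1)) ∧ (m k ≤ j' ∧ j' < m (k + 1))

/-- The defining relations `x² = x` and, for `j, j' ≥ 1` with `j' ⪯ j`,
`x y^j x y^j' x = x y^j x`. -/
inductive SBarRel (m : ℕ → ℕ) : FreeMonoid Letter → FreeMonoid Letter → Prop
  | idem :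
      SBarRel m (FreeMonoid.of Letter.x * FreeMonoid.of Letter.x) (FreeMonoid.of Letter.x)
  | absorb (j j' : ℕ) (hj : 1 ≤ j) (hj' : 1 ≤ j') (h : PrecEq m j' j) :
      SBarRel m
        (FreeMonoid.of Letter.x * FreeMonoid.of Letter.y ^ j * FreeMonoid.of Letter.x *
          FreeMonoid.of Letter.y ^ j' * FreeMonoid.of Letter.x)
        (FreeMonoid.of Letter.x * FreeMonoid.of Letter.y ^ j * FreeMonoid.of Letter.x)

/-- The semigroup with identity generated by `x, y` subject to the relations `SBarRel m`. -/
abbrev SBar (m : ℕ → ℕ) : Type := PresentedMonoid (SBarRel m)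

/-- Events about elements of the (countable) semigroup: every subset is measurable. -/
instance SBar.instMeasurableSpace (m : ℕ → ℕ) : MeasurableSpace (SBar m) := ⊤

instance SBar.instDiscreteMeasurableSpace (m : ℕ → ℕ) : DiscreteMeasurableSpace (SBar m) :=
  ⟨fun _ => trivial⟩

/-- The generating set `{x, y}`. -/
def SBar.gens (m : ℕ → ℕ) : Set (SBar m) :=
  {PresentedMonoid.of (SBarRel m) Letter.x, PresentedMonoid.of (SBarRel m) Letter.y}

/-- `T` is a finite generating set of the monoid `S`. -/
def IsFiniteGeneratingSet {S : Type*} [Monoid S] (T : Set S) : Prop :=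
  T.Finite ∧ Submonoid.closure T = ⊤

/-- The word length `|a|` of `a` with respect to `T`, i.e. the distance from `1` to `a` in the
(directed, right) Cayley graph: the least `k` such that `a` is a product of `k` elements
of `T`. -/
noncomputable def wordLength {S : Type*} [Monoid S] (T : Set S) (a : S) : ℕ :=
  sInf {k : ℕ | ∃ l : List S, (∀ t ∈ l, t ∈ T) ∧ l.length = k ∧ l.prod = a}

/-- `R` is a simple random walk with respect to `T`: `R n = X 0 * X 1 * ⋯ * X (n - 1)`, where the
steps `X i` are independent and uniformly distributed on `T`. -/
def IsSimpleRandomWalk {Ω S : Type*} [MeasurableSpace Ω] [Monoid S] [MeasurableSpace S]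
    [DiscreteMeasurableSpace S] (T : Set S) (μ : Measure Ω) (R : ℕ → Ω → S) : Prop :=
  ∃ X : ℕ → Ω → S,
    (∀ i, Measurable (X i)) ∧
    iIndepFun X μ ∧
    (∀ i, μ.map (X i) = uniformOn T) ∧
    ∀ n ω, R n ω = (List.ofFn fun i : Fin n => X i ω).prod

/-! The element represented by a word remembers whether some interior run `x y^j x` had `j ≥ m k`:
an absorbed run never reaches a threshold that the absorbing run misses. A finite description of
this test (`runHom`) acts through the semigroup, so once such a run has occurred, every word for the
element has length at least `m k` (`le_wordLength_of_found`). A long run occurs with probability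
tending to one (`tendsto_wordMean_zero`), whence the expected length tends to infinity.

Conversely, up to time `m (k + 1)` only the thresholds `m 0, …, m k` matter. Reading from the left,
an interior run lengthens the reduced word only if it raises the maximal level, which happens at
most `k + 1` times. A run that reaches `m k` may be long, but its excess over `m k` is geometric. A
superharmonic majorant (`potential_step_add_le`) makes this precise and bounds the mean by
`lengthBound k (m k)`, independently of `m (k + 1)`. Choosing `m (k + 1)` beyond a time at which `w`
exceeds this bound gives infinitely many slow times. -/

/-! ### Averages over binary words. -/

/-- The average of `f` over all words of length `n` in two letters, one step at a time. -/
noncomputable def wordMean : ℕ → (List Bool → ℝ) → ℝ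
  | 0, f => f []
  | n + 1, f => wordMean n fun l => (f (l ++ [true]) + f (l ++ [false])) / 2

/-- The one-step averaging operator of the free walk on words. -/
noncomputable def stepMean (f : List Bool → ℝ) (l : List Bool) : ℝ :=
  (f (l ++ [true]) + f (l ++ [false])) / 2

lemma wordMean_succ (n : ℕ) (f : List Bool → ℝ) :
    wordMean (n + 1) f = wordMean n (stepMean f) := rfl

lemma wordMean_add (n r : ℕ) (f : List Bool → ℝ) :
    wordMean (n + r) f = wordMean n (stepMean^[r] f) := by
  induction r generalizing f with
  | zero => rfl
  | succ r ih => rw [← add_assoc, wordMean_succ, ih, Function.iterate_succ_apply]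

lemma wordMean_mono {n : ℕ} {f g : List Bool → ℝ} (h : ∀ l, l.length = n → f l ≤ g l) :
    wordMean n f ≤ wordMean n g := by
  induction n generalizing f g with
  | zero => exact h [] rfl
  | succ n ih =>
    refine ih fun l hl => ?_
    have h₁ := h (l ++ [true]) (by simp [hl])
    have h₂ := h (l ++ [false]) (by simp [hl])
    linarith

lemma wordMean_add_fun (n : ℕ) (f g : List Bool → ℝ) :
    wordMean n (fun l => f l + g l) = wordMean n f + wordMean n g := by
  induction n generalizing f g with
  | zero => rfl
  | succ n ih =>
    simp only [wordMean_succ, ← ih]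
    congr 1
    funext l
    simp only [stepMean]
    ring

lemma wordMean_const_mul (n : ℕ) (c : ℝ) (f : List Bool → ℝ) :
    wordMean n (fun l => c * f l) = c * wordMean n f := by
  induction n generalizing f with
  | zero => rfl
  | succ n ih =>
    simp only [wordMean_succ, ← ih]
    congr 1
    funext l
    simp only [stepMean]
    ring

lemma wordMean_const (n : ℕ) (c : ℝ) : wordMean n (fun _ => c) = c := by
  induction n with
  | zero => rfl
  | succ n ih => simpa [wordMean] using ih

/-- A superharmonic function has mean at most its initial value. -/
lemma wordMean_le_of_superharmonic {f : List Bool → ℝ} (h : ∀ l, stepMean f l ≤ f l) (n : ℕ) :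
    wordMean n f ≤ f [] := by
  induction n with
  | zero => exact le_rfl
  | succ n ih => exact (wordMean_mono fun l _ => h l).trans ih

/-- A function that starts below `1` and contracts towards `1` has mean at most `1`. -/
lemma wordMean_le_one_of_contracting {f : List Bool → ℝ} (h₀ : f [] ≤ 1)
    (h : ∀ l, stepMean f l ≤ (f l + 1) / 2) (n : ℕ) : wordMean n f ≤ 1 := by
  induction n with
  | zero => exact h₀
  | succ n ih =>
    have h₁ : wordMean (n + 1) f ≤ wordMean n (fun l => (1 / 2) * f l + 1 / 2) :=
      wordMean_mono fun l _ => (h l).trans (by linarith)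
    rw [wordMean_add_fun, wordMean_const_mul, wordMean_const] at h₁
    linarith

lemma iterate_stepMean_le_one {f : List Bool → ℝ} (h : ∀ l, f l ≤ 1) (r : ℕ) (l : List Bool) :
    stepMean^[r] f l ≤ 1 := by
  induction r generalizing f with
  | zero => exact h l
  | succ r ih =>
    rw [Function.iterate_succ_apply]
    refine ih fun l => ?_
    have h₁ := h (l ++ [true])
    have h₂ := h (l ++ [false])
    simp only [stepMean]
    linarith

lemma iterate_stepMean_succ_apply (f : List Bool → ℝ) (r : ℕ) (l : List Bool) :
    stepMean^[r + 1] f l =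
      (stepMean^[r] f (l ++ [true]) + stepMean^[r] f (l ++ [false])) / 2 := by
  rw [Function.iterate_succ_apply']
  rfl

/-- If `f ≤ 1` vanishes after appending the word `u`, then its mean over the words of the length
of `u` is bounded away from `1`. -/
lemma iterate_stepMean_le {f : List Bool → ℝ} (h : ∀ l, f l ≤ 1) (u l : List Bool)
    (hu : f (l ++ u) = 0) : stepMean^[u.length] f l ≤ 1 - (1 / 2) ^ u.length := by
  induction u generalizing l with
  | nil => simpa using hu.le
  | cons a u ih =>
    rw [List.length_cons, iterate_stepMean_succ_apply, pow_succ]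
    have h₁ := ih (l ++ [a]) (by simpa using hu)
    have h₂ := iterate_stepMean_le_one h u.length (l ++ [!a])
    cases a <;> simp only [Bool.not_true, Bool.not_false] at h₂ <;> linarith

lemma iterate_stepMean_eq_zero {f : List Bool → ℝ} (l : List Bool) (r : ℕ)
    (h : ∀ u, f (l ++ u) = 0) : stepMean^[r] f l = 0 := by
  induction r generalizing l with
  | zero => simpa using h []
  | succ r ih =>
    rw [iterate_stepMean_succ_apply, ih _ fun u => ?_, ih _ fun u => ?_]
    · simp
    · simpa using h (false :: u)
    · simpa using h (true :: u)

/-- If the word `u` occurs as a block and the set where `f ≠ 0` is left for good by appending `u`,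
then the means of the indicator-like function `f` decay geometrically. -/
lemma wordMean_mul_le {f : List Bool → ℝ} (hf : ∀ l, f l = 0 ∨ f l = 1)
    (hzero : ∀ l u, f l = 0 → f (l ++ u) = 0) (u : List Bool) (hu : ∀ l, f (l ++ u) = 0)
    (q : ℕ) : wordMean (q * u.length) f ≤ (1 - (1 / 2) ^ u.length) ^ q := by
  have hle : ∀ l, f l ≤ 1 := fun l => by rcases hf l with h | h <;> simp [h]
  have hδ : (0 : ℝ) ≤ 1 - (1 / 2) ^ u.length :=
    sub_nonneg.2 (pow_le_one₀ (by norm_num) (by norm_num))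
  induction q with
  | zero => simpa [wordMean] using hle []
  | succ q ih =>
    rw [Nat.succ_mul, wordMean_add, pow_succ']
    refine (wordMean_mono (g := fun l => (1 - (1 / 2) ^ u.length) * f l) fun l _ => ?_).trans ?_
    · rcases hf l with h | h
      · rw [iterate_stepMean_eq_zero l _ fun v => hzero l v h, h, mul_zero]
      · rw [h, mul_one]
        exact iterate_stepMean_le hle u l (hu l)
    · rw [wordMean_const_mul]
      exact mul_le_mul_of_nonneg_left ih hδ

lemma wordMean_antitone {f : List Bool → ℝ} (h : ∀ l, stepMean f l ≤ f l) :
    Antitone fun n => wordMean n f :=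
  antitone_nat_of_succ_le fun _ => wordMean_mono fun l _ => h l

/-- The means decrease in `n` and decay geometrically along multiples of `u.length`. -/
lemma tendsto_wordMean_zero {f : List Bool → ℝ} (hf : ∀ l, f l = 0 ∨ f l = 1)
    (hzero : ∀ l u, f l = 0 → f (l ++ u) = 0) (u : List Bool) (hu : ∀ l, f (l ++ u) = 0)
    (hne : u ≠ []) : Tendsto (fun n => wordMean n f) atTop (nhds 0) := by
  have hnn : ∀ n, 0 ≤ wordMean n f := fun n => by
    rw [← wordMean_const n 0]
    exact wordMean_mono fun l _ => by rcases hf l with h | h <;> simp [h]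
  have hanti : Antitone fun n => wordMean n f := wordMean_antitone fun l => by
    rcases hf l with h | h
    · simp [stepMean, hzero l _ h, h]
    · have h₁ : ∀ l, f l ≤ 1 := fun l => by rcases hf l with h | h <;> simp [h]
      have h₂ := h₁ (l ++ [true])
      have h₃ := h₁ (l ++ [false])
      simp only [stepMean, h]
      linarith
  have hlen : 0 < u.length := List.length_pos_iff.2 hne
  have hsub : Tendsto (fun q : ℕ => wordMean (q * u.length) f) atTop (nhds 0) := by
    refine squeeze_zero (fun q => hnn _) (wordMean_mul_le hf hzero u hu) ?_
    refine tendsto_pow_atTop_nhds_zero_of_lt_one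
      (sub_nonneg.2 (pow_le_one₀ (by norm_num) (by norm_num))) ?_
    have : (0 : ℝ) < (1 / 2) ^ u.length := by positivity
    linarith
  rw [Metric.tendsto_atTop] at hsub ⊢
  intro ε hε
  obtain ⟨q, hq⟩ := hsub ε hε
  refine ⟨q * u.length, fun n hn => ?_⟩
  have := hq q le_rfl
  rw [Real.dist_eq, sub_zero, abs_of_nonneg (hnn _)] at this ⊢
  exact (hanti hn).trans_lt this

lemma wordMean_eq_sum (n : ℕ) (f : List Bool → ℝ) :
    wordMean n f = (∑ v : Fin n → Bool, f (List.ofFn v)) / 2 ^ n := by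
  induction n generalizing f with
  | zero => simp [wordMean]
  | succ n ih =>
    rw [wordMean_succ, ih, ← (Fin.snocEquiv fun _ => Bool).sum_comp, Fintype.sum_prod_type]
    simp only [Fintype.sum_bool, Fin.snocEquiv, Equiv.coe_fn_mk, stepMean, List.ofFn_succ',
      Fin.snoc_castSucc, Fin.snoc_last, List.concat_eq_append]
    rw [← Finset.sum_div, Finset.sum_add_distrib, pow_succ, div_div, mul_comm 2]

/-! ### Coin tosses realising the word averages. -/

/-- The law of infinitely many independent fair coin tosses. -/
noncomputable def coinMeasure : Measure (ℕ → Bool) :=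
  Measure.infinitePi fun _ => uniformOn Set.univ

instance : IsProbabilityMeasure coinMeasure := by
  unfold coinMeasure
  infer_instance

lemma coinMeasure_prefix (n : ℕ) (v : Fin n → Bool) :
    coinMeasure ((fun ω (i : Fin n) => ω i) ⁻¹' {v}) = 2⁻¹ ^ n := by
  have h : ((fun ω (i : Fin n) => ω i) ⁻¹' {v} : Set (ℕ → Bool)) =
      Set.pi (Finset.range n) fun i => if h : i < n then {v ⟨i, h⟩} else Set.univ := by
    ext ω
    simp only [Set.mem_preimage, Set.mem_singleton_iff, Set.mem_pi, Finset.coe_range, Set.mem_Iio]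
    constructor
    · rintro rfl i hi
      simp [hi]
    · intro H
      funext i
      simpa using H i i.2
  rw [h, coinMeasure, Measure.infinitePi_pi _ (fun i _ => .of_discrete),
    Finset.prod_congr rfl (g := fun _ => (2⁻¹ : ENNReal))]
  · simp
  · intro i hi
    rw [dif_pos (Finset.mem_range.1 hi), uniformOn_univ]
    simp

lemma integrable_prefix (n : ℕ) (f : List Bool → ℝ) :
    Integrable (fun ω : ℕ → Bool => f (List.ofFn fun i : Fin n => ω i)) coinMeasure := by
  have hm : Measurable fun (ω : ℕ → Bool) (i : Fin n) => ω i := by fun_prop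
  have : IsFiniteMeasure (coinMeasure.map fun (ω : ℕ → Bool) (i : Fin n) => ω i) := inferInstance
  exact (Integrable.of_finite (f := fun v : Fin n → Bool => f (List.ofFn v))).comp_measurable hm

lemma integral_prefix (n : ℕ) (f : List Bool → ℝ) :
    ∫ ω, f (List.ofFn fun i : Fin n => ω i) ∂coinMeasure = wordMean n f := by
  have hm : Measurable fun (ω : ℕ → Bool) (i : Fin n) => ω i := by fun_prop
  rw [← integral_map (φ := fun (ω : ℕ → Bool) (i : Fin n) => ω i)
    (f := fun v : Fin n → Bool => f (List.ofFn v)) hm.aemeasurable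
    Measurable.of_discrete.aestronglyMeasurable,
    integral_fintype .of_finite, wordMean_eq_sum, Finset.sum_div]
  refine Finset.sum_congr rfl fun v _ => ?_
  rw [Measure.real, Measure.map_apply hm (.singleton v), coinMeasure_prefix]
  simp [div_eq_inv_mul]

/-! ### Word length in a monoid. -/

lemma wordLength_le {S : Type*} [Monoid S] {T : Set S} {a : S} (l : List S)
    (hl : ∀ t ∈ l, t ∈ T) (ha : l.prod = a) : wordLength T a ≤ l.length :=
  Nat.sInf_le ⟨l, hl, rfl, ha⟩

lemma exists_list_of_wordLength {S : Type*} [Monoid S] {T : Set S}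
    (hT : Submonoid.closure T = ⊤) (a : S) :
    ∃ l : List S, (∀ t ∈ l, t ∈ T) ∧ l.length = wordLength T a ∧ l.prod = a := by
  have h : a ∈ Submonoid.closure T := hT ▸ Submonoid.mem_top a
  obtain ⟨l, hl, ha⟩ := Submonoid.exists_list_of_mem_closure h
  exact Nat.sInf_mem (s := {k : ℕ | ∃ l : List S, (∀ t ∈ l, t ∈ T) ∧ l.length = k ∧ l.prod = a})
    ⟨_, l, hl, rfl, ha⟩

lemma wordLength_mul_le {S : Type*} [Monoid S] {T : Set S} (hT : Submonoid.closure T = ⊤)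
    (a b : S) : wordLength T (a * b) ≤ wordLength T a + wordLength T b := by
  obtain ⟨l, hl, hlen, rfl⟩ := exists_list_of_wordLength hT a
  obtain ⟨l', hl', hlen', rfl⟩ := exists_list_of_wordLength hT b
  rw [← hlen, ← hlen', ← List.length_append]
  exact wordLength_le _ (by simpa [or_imp, forall_and] using ⟨hl, hl'⟩) (by simp)

lemma wordLength_le_one {S : Type*} [Monoid S] {T : Set S} {a : S} (ha : a ∈ T) :
    wordLength T a ≤ 1 :=
  wordLength_le [a] (by simpa using ha) (by simp)

lemma wordLength_pow_le {S : Type*} [Monoid S] {T : Set S} {a : S} (ha : a ∈ T) (n : ℕ) :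
    wordLength T (a ^ n) ≤ n :=
  (wordLength_le (List.replicate n a) (fun _ ht => List.eq_of_mem_replicate ht ▸ ha)
    (by simp)).trans (by simp)

/-! ### Generators and relations of the semigroup. -/

namespace SBar

variable (m : ℕ → ℕ)

/-- The generator `x` for `true` and the generator `y` for `false`. -/
def gen : Bool → SBar m
  | true => PresentedMonoid.of (SBarRel m) Letter.x
  | false => PresentedMonoid.of (SBarRel m) Letter.y

/-- The element of `SBar m` represented by a word. -/
def eval (l : List Bool) : SBar m := (l.map (gen m)).prod

lemma range_gen : Set.range (gen m) = gens m := by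
  rw [Bool.range_eq, Set.pair_comm]
  rfl

lemma gen_mem_gens (b : Bool) : gen m b ∈ gens m := range_gen m ▸ Set.mem_range_self b

lemma eval_append_singleton (l : List Bool) (b : Bool) :
    eval m (l ++ [b]) = eval m l * gen m b := by
  simp [eval]

lemma isFiniteGeneratingSet_gens : IsFiniteGeneratingSet (gens m) := by
  refine ⟨by simp [gens], ?_⟩
  rw [← PresentedMonoid.closure_range_of]
  congr 1
  ext a
  constructor
  · rintro (rfl | rfl)
    exacts [⟨_, rfl⟩, ⟨_, rfl⟩]
  · rintro ⟨_ | _, rfl⟩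
    exacts [Or.inl rfl, Or.inr rfl]

lemma gen_true_mul_self : gen m true * gen m true = gen m true :=
  PresentedMonoid.mk_eq_mk_of_rel SBarRel.idem

lemma gen_absorb {j j' : ℕ} (hj : 1 ≤ j) (hj' : 1 ≤ j') (h : PrecEq m j' j) :
    gen m true * gen m false ^ j * gen m true * gen m false ^ j' * gen m true =
      gen m true * gen m false ^ j * gen m true := by
  have := PresentedMonoid.mk_eq_mk_of_rel (SBarRel.absorb (m := m) j j' hj hj' h)
  simp only [map_mul, map_pow] at this
  exact this

/-- The homomorphism to multiplicative `ℕ` with `x ↦ 0`, `y ↦ 1` separates the generators. This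
makes a fair coin induce the uniform law on them. -/
lemma gen_injective : Function.Injective (gen m) := by
  let φ : SBar m →* ℕ := PresentedMonoid.lift (fun a => match a with | .x => 0 | .y => 1) <| by
    intro a b h
    cases h <;> simp
  have hx : φ (gen m true) = 0 := PresentedMonoid.lift_of _ _
  have hy : φ (gen m false) = 1 := PresentedMonoid.lift_of _ _
  have hne : gen m true ≠ gen m false := fun h => by simp [h, hy] at hx
  rintro (_ | _) (_ | _) h
  exacts [rfl, absurd h.symm hne, absurd h hne, rfl]

end SBar

/-! ### Long interior runs are detected by the semigroup -/

/-- State of the automaton looking for an interior block `x y^j x` with `j ≥ M`: `none` before the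
first `x`; then the current run of `y` and whether a long block has been seen. -/
abbrev RunState : Type := Option (ℕ × Prop)

/-- Transition of the automaton looking for long interior runs. -/
def RunState.step (M : ℕ) : Bool → RunState → RunState
  | true, none => some (0, False)
  | true, some (t, p) => some (0, p ∨ M ≤ t)
  | false, none => none
  | false, some (t, p) => some (t + 1, p)

/-- A long interior run has been seen. -/
def RunState.found : RunState → Prop
  | none => False
  | some (_, p) => p

namespace SBar

variable {m : ℕ → ℕ}

lemma iterate_step_false_some (M t j : ℕ) (p : Prop) :
    (RunState.step M false)^[j] (some (t, p)) = some (t + j, p) := by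
  induction j generalizing t with
  | zero => rfl
  | succ j ih =>
    rw [Function.iterate_succ_apply]
    exact (ih (t + 1)).trans (by rw [add_right_comm, add_assoc])

lemma exists_step_true (M : ℕ) (s : RunState) : ∃ p, RunState.step M true s = some (0, p) := by
  rcases s with _ | ⟨t, p⟩
  exacts [⟨_, rfl⟩, ⟨_, rfl⟩]

/-- Each interval in the definition of `⪯` starts at a threshold, so passing from `j` to `j'` never
crosses a threshold upwards. This is what makes the run automaton respect absorption. -/
lemma le_of_precEq (hm : StrictMono m) {j j' k : ℕ} (h : PrecEq m j' j) (hk : m k ≤ j') :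
    m k ≤ j := by
  rcases h with ⟨i, h₁, h₂⟩ | ⟨i, ⟨h₁, -⟩, -, h₃⟩
  · omega
  · have := hm.lt_iff_lt.1 (hk.trans_lt h₃)
    exact (hm.monotone (Nat.lt_succ_iff.1 this)).trans h₁

/-- The run automaton acts on the right through the semigroup. -/
def runHom (hm : StrictMono m) (k : ℕ) (hk : 0 < m k) :
    SBar m →* (Function.End RunState)ᵐᵒᵖ :=
  PresentedMonoid.lift
    (fun a => match a with
      | .x => MulOpposite.op (RunState.step (m k) true)
      | .y => MulOpposite.op (RunState.step (m k) false)) <| by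
    intro a b h
    cases h with
    | idem =>
      simp only [map_mul, FreeMonoid.lift_eval_of]
      refine MulOpposite.unop_injective (funext fun s => ?_)
      obtain ⟨p, hp⟩ := exists_step_true (m k) s
      change RunState.step (m k) true (RunState.step (m k) true s) = RunState.step (m k) true s
      rw [hp]
      -- The empty run between the two letters `x` is not long, as `m k > 0`.
      simp [RunState.step, hk.ne']
    | absorb j j' hj hj' h =>
      simp only [map_mul, map_pow, FreeMonoid.lift_eval_of]
      refine MulOpposite.unop_injective (funext fun s => ?_)
      change RunState.step (m k) true ((RunState.step (m k) false)^[j'] (RunState.step (m k) true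
        ((RunState.step (m k) false)^[j] (RunState.step (m k) true s)))) =
        RunState.step (m k) true ((RunState.step (m k) false)^[j] (RunState.step (m k) true s))
      obtain ⟨p, hp⟩ := exists_step_true (m k) s
      rw [hp, iterate_step_false_some]
      have : (p ∨ m k ≤ j) ∨ m k ≤ j' ↔ p ∨ m k ≤ j := by
        have := le_of_precEq hm (k := k) h
        tauto
      simp only [RunState.step, iterate_step_false_some, zero_add, this]

/-- The state of the run automaton after reading a word. -/
def runState (M : ℕ) (l : List Bool) : RunState := l.foldl (fun s b => RunState.step M b s) none

lemma runHom_eval (hm : StrictMono m) (k : ℕ) (hk : 0 < m k) (l : List Bool) :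
    (runHom hm k hk (eval m l)).unop none = runState (m k) l := by
  induction l using List.reverseRecOn with
  | nil => rfl
  | append_singleton l b ih =>
    rw [eval_append_singleton, map_mul, MulOpposite.unop_mul]
    have : (runHom hm k hk (gen m b)).unop = RunState.step (m k) b := by
      cases b <;> rfl
    rw [this]
    change RunState.step (m k) b ((runHom hm k hk (eval m l)).unop none) = _
    rw [ih]
    simp [runState]

lemma runState_bound (M : ℕ) (l : List Bool) :
    ∀ t p, runState M l = some (t, p) → t ≤ l.length ∧ (p → M ≤ l.length) := by
  induction l using List.reverseRecOn with
  | nil => simp [runState]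
  | append_singleton l b ih =>
    intro t p h
    have hs : RunState.step M b (runState M l) = some (t, p) := by simpa [runState] using h
    rw [List.length_append, List.length_singleton]
    rcases hrun : runState M l with _ | ⟨t', p'⟩
    · rw [hrun] at hs
      cases b <;> simp only [RunState.step, reduceCtorEq, Option.some.injEq, Prod.mk.injEq] at hs
      obtain ⟨rfl, rfl⟩ := hs
      simp
    · rw [hrun] at hs
      obtain ⟨h₁, h₂⟩ := ih _ _ hrun
      cases b <;> simp only [RunState.step, Option.some.injEq, Prod.mk.injEq] at hs <;>
        obtain ⟨rfl, rfl⟩ := hs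
      · exact ⟨by omega, fun hp => (h₂ hp).trans (by omega)⟩
      · exact ⟨by omega, fun hp => hp.elim (fun hp => (h₂ hp).trans (by omega)) (by omega)⟩

lemma exists_word (a : SBar m) : ∃ l, l.length = wordLength (gens m) a ∧ eval m l = a := by
  obtain ⟨l, hl, hlen, ha⟩ := exists_list_of_wordLength (isFiniteGeneratingSet_gens m).2 a
  rw [← range_gen] at hl
  obtain ⟨l, rfl⟩ : ∃ l', List.map (gen m) l' = l := by
    rw [← Set.mem_range, Set.range_list_map]
    exact hl
  exact ⟨l, by simpa using hlen, ha⟩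

/-- The final state depends only on the element, so a shortest word for it also contains a long run.
-/
lemma le_wordLength_of_found (hm : StrictMono m) (k : ℕ) (hk : 0 < m k) {l : List Bool}
    (h : (runState (m k) l).found) : m k ≤ wordLength (gens m) (eval m l) := by
  obtain ⟨l', hlen, he⟩ := exists_word (eval m l)
  rw [← hlen]
  rw [← runHom_eval hm k hk, ← he, runHom_eval] at h
  rcases hs : runState (m k) l' with _ | ⟨t, p⟩
  · rw [hs] at h
    exact h.elim
  · rw [hs] at h
    exact (runState_bound _ _ _ _ hs).2 h

lemma found_append {M : ℕ} {l : List Bool} (h : (runState M l).found) (u : List Bool) :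
    (runState M (l ++ u)).found := by
  induction u using List.reverseRecOn with
  | nil => simpa using h
  | append_singleton u b ih =>
    have : runState M (l ++ (u ++ [b])) = RunState.step M b (runState M (l ++ u)) := by
      simp [runState]
    rw [this]
    rcases hs : runState M (l ++ u) with _ | ⟨t, p⟩
    · rw [hs] at ih
      exact ih.elim
    · rw [hs] at ih
      cases b
      · exact ih
      · exact Or.inl ih

lemma found_append_block (M : ℕ) (l : List Bool) :
    (runState M (l ++ (true :: (List.replicate M false ++ [true])))).found := by
  obtain ⟨p, hp⟩ := exists_step_true M (runState M l)
  have hrep : ∀ (n : ℕ) (s : RunState), (List.replicate n false).foldl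
      (fun s b => RunState.step M b s) s = (RunState.step M false)^[n] s := by
    intro n
    induction n with
    | zero => intro s; rfl
    | succ n ih =>
      intro s
      rw [List.replicate_succ, List.foldl_cons, ih, Function.iterate_succ_apply]
  rw [runState] at hp ⊢
  rw [List.foldl_append, List.foldl_cons, hp, List.foldl_append, hrep, iterate_step_false_some]
  exact Or.inr (by simp)

/-- The expected length of the walk tends to infinity. -/
lemma tendsto_wordMean_wordLength (hm : StrictMono m) (h₀ : m 0 = 1) :
    Tendsto (fun n => wordMean n fun l => (wordLength (gens m) (eval m l) : ℝ)) atTop atTop := by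
  classical
  refine tendsto_atTop.2 fun B => ?_
  -- The factor 2 compensates for waiting only until the long run has probability above one half.
  obtain ⟨k, hk⟩ := exists_nat_ge (2 * B)
  have hpos : ∀ k, 0 < m k := fun k => by
    have := hm.monotone (Nat.zero_le k)
    omega
  have hkB : 2 * B ≤ m k := hk.trans (by exact_mod_cast hm.le_apply)
  let f : List Bool → ℝ := fun l => if (runState (m k) l).found then 0 else 1
  have hf : Tendsto (fun n => wordMean n f) atTop (nhds 0) := by
    refine tendsto_wordMean_zero (fun l => ?_) (fun l u h => ?_)
      (true :: (List.replicate (m k) false ++ [true])) (fun l => ?_) (by simp)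
    · by_cases h : (runState (m k) l).found <;> simp [f, h]
    · have : (runState (m k) l).found := by
        by_contra hn
        simp [f, hn] at h
      exact if_pos (found_append this u)
    · exact if_pos (found_append_block _ l)
  filter_upwards [hf.eventually (gt_mem_nhds (by norm_num : (0 : ℝ) < 1 / 2))] with n hn
  have hle : wordMean n (fun l => (m k : ℝ) + -(m k : ℝ) * f l) ≤
      wordMean n fun l => (wordLength (gens m) (eval m l) : ℝ) := by
    refine wordMean_mono fun l _ => ?_
    by_cases h : (runState (m k) l).found
    · simpa [f, h] using le_wordLength_of_found hm k (hpos k) h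
    · simp [f, h]
  rw [wordMean_add_fun, wordMean_const, wordMean_const_mul] at hle
  have : (0 : ℝ) < m k := by exact_mod_cast hpos k
  nlinarith

end SBar

/-! ### Reduced words and the upper bound. -/

/-- The number of thresholds `m 0, …, m k` that are at most `j`. -/
def level (m : ℕ → ℕ) (k j : ℕ) : ℕ := ((Finset.range (k + 1)).filter fun i => m i ≤ j).card

lemma level_le (m : ℕ → ℕ) (k j : ℕ) : level m k j ≤ k + 1 :=
  (Finset.card_filter_le _ _).trans (by simp)

/-- By monotonicity, the thresholds counted by `level` form an initial segment. -/
lemma lt_level_iff {m : ℕ → ℕ} (hm : StrictMono m) {k i j : ℕ} (hi : i ≤ k) :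
    i < level m k j ↔ m i ≤ j := by
  constructor
  · intro h
    by_contra hlt
    have : (Finset.range (k + 1)).filter (fun i => m i ≤ j) ⊆ Finset.range i := by
      intro a ha
      rw [Finset.mem_filter] at ha
      rw [Finset.mem_range, ← hm.lt_iff_lt]
      omega
    have := Finset.card_le_card this
    rw [Finset.card_range] at this
    exact absurd h (not_lt.2 this)
  · intro h
    have : Finset.range (i + 1) ⊆ (Finset.range (k + 1)).filter fun i => m i ≤ j := by
      intro a ha
      rw [Finset.mem_range] at ha
      rw [Finset.mem_filter, Finset.mem_range]
      exact ⟨by omega, (hm.monotone (Nat.lt_succ_iff.1 ha)).trans h⟩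
    have := Finset.card_le_card this
    rwa [Finset.card_range] at this

lemma precEq_of_level_le {m : ℕ → ℕ} (hm : StrictMono m) (h₀ : m 0 = 1) {k j j' : ℕ} (hj : 1 ≤ j)
    (hj' : j' < m (k + 1)) (h : level m k j' ≤ level m k j) : PrecEq m j' j := by
  by_cases hk : m (k + 1) ≤ j
  -- Here `level` has saturated, but `m (k + 1)` itself separates `j'` from `j`.
  · exact Or.inl ⟨k + 1, hj', hk⟩
  push Not at hk
  obtain ⟨K, hK⟩ : ∃ K, level m k j = K + 1 :=
    Nat.exists_eq_succ_of_ne_zero ((lt_level_iff hm (Nat.zero_le k)).2 (h₀ ▸ hj)).ne'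
  have hKk : K ≤ k := by
    have := level_le m k j
    omega
  have hlow : m K ≤ j := (lt_level_iff hm hKk).1 (by omega)
  have hup : ∀ i, i < m (k + 1) → level m k i ≤ K + 1 → i < m (K + 1) := by
    intro i hi hl
    rcases hKk.lt_or_eq with hlt | rfl
    · by_contra hn
      have := (lt_level_iff hm (k := k) (i := K + 1) (j := i) (by omega)).2 (by omega)
      omega
    · exact hi
  have hj'' := hup j' hj' (by omega)
  rcases lt_or_ge j' (m K) with hlt | hge
  · exact Or.inl ⟨K, hlt, hlow⟩
  · exact Or.inr ⟨K, ⟨hlow, hup j hk (by omega)⟩, hge, hj''⟩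

/-- Shape of a partially reduced word: either a power of `y`, or a reduced word of length `len`
ending in `x` whose interior runs have level at most `lev`, followed by a run of `y`. -/
inductive ReducedShape : Type
  | initial (run : ℕ)
  | main (len lev run : ℕ)

namespace ReducedShape

/-- Update of the shape when a letter is appended. -/
def step (m : ℕ → ℕ) (k : ℕ) : ReducedShape → Bool → ReducedShape
  | initial t, true => main (t + 1) 0 0
  | initial t, false => initial (t + 1)
  | main n K t, true =>
    if level m k t ≤ K then main n K 0 else main (n + t + 1) (level m k t) 0
  | main n K t, false => main n K (t + 1)

/-- The shape of a word. -/
def ofWord (m : ℕ → ℕ) (k : ℕ) (l : List Bool) : ReducedShape := l.foldl (step m k) (initial 0)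

lemma ofWord_append_singleton (m : ℕ → ℕ) (k : ℕ) (l : List Bool) (b : Bool) :
    ofWord m k (l ++ [b]) = step m k (ofWord m k l) b := by
  simp [ofWord]

/-- The length of the current run. -/
def run : ReducedShape → ℕ
  | initial t => t
  | main _ _ t => t

/-- The length of the reduced word. -/
def length : ReducedShape → ℕ
  | initial t => t
  | main n _ t => n + t

/-- Bound for the expected future growth in front of the current run. -/
def growth (k M K t : ℕ) : ℕ :=
  if k + 1 ≤ K then 0 else max t M + 2 + (k + 1 - K) * (M + 2)

/-- A superharmonic majorant of the length without the current run. -/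
def potential (k M : ℕ) : ReducedShape → ℕ
  | initial t => t + 2 + growth k M 0 0
  | main n K t => n + growth k M K t

lemma length_le (k M : ℕ) (s : ReducedShape) : s.length ≤ s.potential k M + s.run := by
  rcases s with t | ⟨n, K, t⟩ <;> simp only [length, potential, run] <;> omega

lemma run_step_add (m : ℕ → ℕ) (k : ℕ) (s : ReducedShape) :
    (s.step m k true).run + (s.step m k false).run = s.run + 1 := by
  rcases s with t | ⟨n, K, t⟩
  · simp [step, run]
  · by_cases h : level m k t ≤ K <;> simp [step, run, h]

/-- While `K ≤ k`, the growth reserves `max t M + 2` for the final jump and `M + 2` for each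
remaining level. A jump below the top level adds at most `M`, paid for by the level it uses up; a
run `t ≥ M` is paid for by `max t M`. -/
lemma potential_step_add_le {m : ℕ → ℕ} (hm : StrictMono m) (k : ℕ) (s : ReducedShape) :
    (s.step m k true).potential k (m k) + (s.step m k false).potential k (m k) ≤
      2 * s.potential k (m k) := by
  rcases s with t | ⟨n, K, t⟩
  · simp only [step, potential]
    omega
  · have htop := lt_level_iff hm (j := t) (le_refl k)
    have hlev := level_le m k t
    by_cases hK : k + 1 ≤ K
    · have h : level m k t ≤ K := by omega
      simp [step, potential, growth, h, hK]
      omega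
    · by_cases h : level m k t ≤ K
      · have : ¬ m k ≤ t := fun hn => by
          have := htop.2 hn
          omega
        simp only [step, if_pos h, potential, growth, if_neg hK]
        omega
      · by_cases hkt : m k ≤ t
        · have : k + 1 ≤ level m k t := htop.2 hkt
          simp only [step, if_neg h, potential, growth, if_neg hK, if_pos this]
          omega
        · have hlt : ¬ k + 1 ≤ level m k t := fun hn => hkt (htop.1 hn)
          have hmul : (k + 1 - level m k t) * (m k + 2) + (m k + 2) ≤
              (k + 1 - K) * (m k + 2) := by
            rw [← Nat.succ_mul]
            exact Nat.mul_le_mul_right _ (by omega)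
          simp only [step, if_neg h, potential, growth, if_neg hK, if_neg hlt]
          omega

lemma run_ofWord_le (m : ℕ → ℕ) (k : ℕ) (l : List Bool) : (ofWord m k l).run ≤ l.length := by
  induction l using List.reverseRecOn with
  | nil => simp [ofWord, run]
  | append_singleton l b ih =>
    rw [ofWord_append_singleton, List.length_append, List.length_singleton]
    have h := run_step_add m k (ofWord m k l)
    cases b <;> omega

/-- The semigroup element `a` can be written in the given shape, the reduced part of which absorbs
the runs `y ^ j x` with `j < N` of no larger level. -/
def Represents (m : ℕ → ℕ) (k : ℕ) : ReducedShape → SBar m → Prop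
  | initial t, a => a = SBar.gen m false ^ t
  | main n K t, a => ∃ u, wordLength (SBar.gens m) u ≤ n ∧ u * SBar.gen m true = u ∧
      (∀ j, 1 ≤ j → j < m (k + 1) → level m k j ≤ K →
        u * SBar.gen m false ^ j * SBar.gen m true = u) ∧ a = u * SBar.gen m false ^ t

lemma Represents.wordLength_le {m : ℕ → ℕ} {k : ℕ} {s : ReducedShape} {a : SBar m}
    (h : Represents m k s a) : wordLength (SBar.gens m) a ≤ s.length := by
  have hpow := wordLength_pow_le (SBar.gen_mem_gens m false)
  rcases s with t | ⟨n, K, t⟩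
  · rw [show a = SBar.gen m false ^ t from h]
    exact hpow t
  · obtain ⟨u, hu, -, -, rfl⟩ := h
    exact (wordLength_mul_le (SBar.isFiniteGeneratingSet_gens m).2 _ _).trans
      (add_le_add hu (hpow t))

/-- A closing `x` either absorbs the run, when its level is at most `K`, or makes it the new
dominant run, which then absorbs all runs shorter than `m (k + 1)` of no larger level. -/
lemma Represents.step {m : ℕ → ℕ} (hm : StrictMono m) (h₀ : m 0 = 1) {k : ℕ} {s : ReducedShape}
    {a : SBar m} (h : Represents m k s a) (hrun : s.run < m (k + 1)) (b : Bool) :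
    Represents m k (s.step m k b) (a * SBar.gen m b) := by
  have hcl := (SBar.isFiniteGeneratingSet_gens m).2
  have hpow := wordLength_pow_le (SBar.gen_mem_gens m false)
  have hone := wordLength_le_one (SBar.gen_mem_gens m true)
  rcases s with t | ⟨n, K, t⟩
  · have ha : a = SBar.gen m false ^ t := h
    subst ha
    cases b
    · exact (pow_succ _ _).symm
    · refine ⟨SBar.gen m false ^ t * SBar.gen m true, ?_, ?_, fun j hj hjk hl => ?_, ?_⟩
      · exact (wordLength_mul_le hcl _ _).trans (add_le_add (hpow t) hone)
      · rw [mul_assoc, SBar.gen_true_mul_self]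
      -- Vacuous: since `m 0 = 1`, every nonempty run has positive level.
      · have := (lt_level_iff hm (Nat.zero_le k)).2 (h₀.trans_le hj)
        omega
      · rw [pow_zero, mul_one]
  · obtain ⟨u, hu, hux, habs, rfl⟩ := h
    cases b
    · exact ⟨u, hu, hux, habs, by rw [pow_succ, mul_assoc]⟩
    · have hrun' : t < m (k + 1) := hrun
      by_cases hl : level m k t ≤ K
      · simp only [ReducedShape.step, if_pos hl]
        refine ⟨u, hu, hux, habs, ?_⟩
        rcases Nat.eq_zero_or_pos t with rfl | ht
        · rw [pow_zero, mul_one, hux]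
        · rw [habs t ht hrun' hl, pow_zero, mul_one]
      · simp only [ReducedShape.step, if_neg hl]
        have ht : 1 ≤ t := by
          by_contra hn
          have : ¬ 0 < level m k t := fun hp => by
            have := (lt_level_iff hm (Nat.zero_le k)).1 hp
            omega
          omega
        refine ⟨u * SBar.gen m false ^ t * SBar.gen m true, ?_, ?_, fun j hj hjk hlj => ?_, ?_⟩
        · exact (wordLength_mul_le hcl _ _).trans (add_le_add
            ((wordLength_mul_le hcl _ _).trans (add_le_add hu (hpow t))) hone)
        · rw [mul_assoc, SBar.gen_true_mul_self]
        · have := SBar.gen_absorb m ht hj (precEq_of_level_le hm h₀ ht hjk hlj)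
          -- The extra `x` at the end of `u` supplies the left end of the defining relation.
          rw [← hux]
          simp only [mul_assoc] at this ⊢
          rw [this]
        · rw [pow_zero, mul_one]

lemma represents_ofWord {m : ℕ → ℕ} (hm : StrictMono m) (h₀ : m 0 = 1) (k : ℕ) (l : List Bool)
    (hl : l.length ≤ m (k + 1)) : Represents m k (ofWord m k l) (SBar.eval m l) := by
  induction l using List.reverseRecOn with
  | nil => simp [ofWord, Represents, SBar.eval]
  | append_singleton l b ih =>
    rw [List.length_append, List.length_singleton] at hl
    rw [ofWord_append_singleton, SBar.eval_append_singleton]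
    exact (ih (by omega)).step hm h₀ ((run_ofWord_le m k l).trans_lt (by omega)) b

end ReducedShape

/-- Bound for the expected length up to time `m (k + 1)` in terms of `k` and `m k` alone. -/
def lengthBound (k M : ℕ) : ℕ := 3 + ReducedShape.growth k M 0 0

lemma SBar.wordMean_wordLength_le {m : ℕ → ℕ} (hm : StrictMono m) (h₀ : m 0 = 1) {k n : ℕ}
    (hn : n ≤ m (k + 1)) :
    wordMean n (fun l => (wordLength (gens m) (eval m l) : ℝ)) ≤ lengthBound k (m k) := by
  let S := ReducedShape.ofWord m k
  have hpot : wordMean n (fun l => ((S l).potential k (m k) : ℝ)) ≤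
      (S []).potential k (m k) :=
    wordMean_le_of_superharmonic (fun l => by
      have h : ((_ : ℕ) : ℝ) ≤ (_ : ℕ) :=
        Nat.cast_le.2 (ReducedShape.potential_step_add_le hm k (S l))
      push_cast at h
      simp only [stepMean, S, ReducedShape.ofWord_append_singleton] at h ⊢
      linarith) n
  have hrun : wordMean n (fun l => ((S l).run : ℝ)) ≤ 1 :=
    wordMean_le_one_of_contracting (by simp [S, ReducedShape.ofWord, ReducedShape.run])
      (fun l => by
        have h : ((_ : ℕ) : ℝ) = (_ : ℕ) :=
          congrArg Nat.cast (ReducedShape.run_step_add m k (S l))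
        push_cast at h
        simp only [stepMean, S, ReducedShape.ofWord_append_singleton] at h ⊢
        linarith) n
  calc wordMean n (fun l => (wordLength (gens m) (eval m l) : ℝ))
      ≤ wordMean n (fun l => ((S l).potential k (m k) : ℝ) + ((S l).run : ℝ)) :=
        wordMean_mono fun l hl => by
          exact_mod_cast (ReducedShape.represents_ofWord hm h₀ k l
            (hl.trans_le hn)).wordLength_le.trans (ReducedShape.length_le k (m k) _)
    _ ≤ (S []).potential k (m k) + 1 := by
        rw [wordMean_add_fun]
        exact add_le_add hpot hrun
    _ = lengthBound k (m k) := by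
        simp only [S, ReducedShape.ofWord, List.foldl_nil, ReducedShape.potential, lengthBound]
        push_cast
        ring

/-! ### The random walk and the choice of thresholds. -/

namespace SBar

lemma map_gen_uniformOn (m : ℕ → ℕ) :
    (uniformOn (Set.univ : Set Bool)).map (gen m) = uniformOn (gens m) := by
  ext s -
  rw [Measure.map_apply .of_discrete .of_discrete, uniformOn, uniformOn, cond_apply .univ,
    cond_apply .of_discrete, Set.univ_inter, ← range_gen, ← Set.image_preimage_eq_range_inter,
    Measure.count_injective_image (gen_injective m), ← Set.image_univ,
    Measure.count_injective_image (gen_injective m)]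

/-- The random walk driven by a sequence of coin tosses. -/
def walk (m : ℕ → ℕ) (n : ℕ) (ω : ℕ → Bool) : SBar m := eval m (List.ofFn fun i : Fin n => ω i)

lemma isSimpleRandomWalk_walk (m : ℕ → ℕ) :
    IsSimpleRandomWalk (gens m) coinMeasure (walk m) := by
  refine ⟨fun i ω => gen m (ω i), fun i => ?_, ?_, fun i => ?_, fun n ω => ?_⟩
  · exact (Measurable.of_discrete (f := gen m)).comp (measurable_pi_apply i)
  · exact iIndepFun_infinitePi (P := fun _ : ℕ => uniformOn (Set.univ : Set Bool))
      (X := fun _ => gen m) fun _ => Measurable.of_discrete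
  · rw [← map_gen_uniformOn, ← Measure.infinitePi_map_eval
      (fun _ : ℕ => uniformOn (Set.univ : Set Bool)) i,
      Measure.map_map (g := gen m) Measurable.of_discrete (measurable_pi_apply i)]
    rfl
  · rw [walk, eval, List.map_ofFn]
    rfl

end SBar

/-- A rapidly increasing sequence whose next term exceeds a prescribed function of the index and
of the current term. -/
def sparseSeq (g : ℕ → ℕ → ℕ) : ℕ → ℕ
  | 0 => 1
  | k + 1 => 2 ^ sparseSeq g k + g k (sparseSeq g k) + 1

theorem theoremB (w : ℕ → ℝ) (hw : Tendsto w atTop atTop) :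
    ∃ m : ℕ → ℕ, StrictMono m ∧ m 0 = 1 ∧ (∀ k, 2 ^ m k < m (k + 1)) ∧
      IsFiniteGeneratingSet (SBar.gens m) ∧
      ∃ (Ω : Type) (_ : MeasurableSpace Ω) (μ : Measure Ω) (_ : IsProbabilityMeasure μ)
        (R : ℕ → Ω → SBar m),
        IsSimpleRandomWalk (SBar.gens m) μ R ∧
        (∀ n, Integrable (fun ω => (wordLength (SBar.gens m) (R n ω) : ℝ)) μ) ∧
        (∃ᶠ n in atTop, ∫ ω, (wordLength (SBar.gens m) (R n ω) : ℝ) ∂μ ≤ w n) ∧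
        Tendsto (fun n => ∫ ω, (wordLength (SBar.gens m) (R n ω) : ℝ) ∂μ) atTop atTop := by
  -- The bound involves only `k` and `m k`, so the slow time can be chosen before `m (k + 1)`;
  -- requiring `k ≤ n` makes these times unbounded.
  have hex : ∀ k M : ℕ, ∃ n, k ≤ n ∧ (lengthBound k M : ℝ) ≤ w n := fun k M =>
    ((eventually_ge_atTop k).and (hw.eventually_ge_atTop _)).exists
  choose g hg hgw using hex
  let m := sparseSeq g
  have hpow : ∀ k, 2 ^ m k < m (k + 1) := fun k => by
    change 2 ^ m k < 2 ^ m k + g k (m k) + 1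
    omega
  have hm : StrictMono m := strictMono_nat_of_lt_succ fun k => Nat.lt_two_pow_self.trans (hpow k)
  have hint : ∀ n, ∫ ω, (wordLength (SBar.gens m) (SBar.walk m n ω) : ℝ) ∂coinMeasure =
      wordMean n fun l => (wordLength (SBar.gens m) (SBar.eval m l) : ℝ) := fun n =>
    integral_prefix n fun l => (wordLength (SBar.gens m) (SBar.eval m l) : ℝ)
  refine ⟨m, hm, rfl, hpow, SBar.isFiniteGeneratingSet_gens m, ℕ → Bool, inferInstance,
    coinMeasure, inferInstance, SBar.walk m, SBar.isSimpleRandomWalk_walk m, fun n => ?_, ?_, ?_⟩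
  · exact integrable_prefix n fun l => (wordLength (SBar.gens m) (SBar.eval m l) : ℝ)
  · refine frequently_atTop.2 fun k => ⟨g k (m k), hg k (m k), ?_⟩
    rw [hint]
    refine (SBar.wordMean_wordLength_le hm rfl ?_).trans (hgw k (m k))
    exact (Nat.le_add_left _ _).trans (Nat.le_succ _)
  · simp only [hint]
    exact SBar.tendsto_wordMean_wordLength hm rfl
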